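/- Let $K$ be a compact semisimple Lie group and let $\rho: K \to \mathrm{GL}(n+1,\mathbb{C})$ be a smooth linear representation such that the induced action of $K$ on $\mathbb{CP}^n$ is Hamiltonian with respect to the Fubini--Study form $\omega_{FS}$; that is, $K$ acts by symplectic diffeomorphisms and there is a smooth map $\mu:\mathbb{CP}^n\to\mathfrak{k}^*$ with $d\mu^X=\iota_{X^\#}\omega_{FS}$ for all $X\in\mathfrak{k}$ and $\mu(kp)=\mathrm{Ad}^*(k)\mu(p)$ for all $k\in K$. Let $S^1\times K$ act on $\mathbb{C}^{n+1}$, with its standard symplectic form $\sum_j dx_j\wedge dy_j$, by $(z,k)\cdot v = z\,\rho(k)v$. Call an orbit Lagrangian if its dimension is half the real dimension of the manifold and the symplectic form vanishes on its tangent spaces. Then $K$ has a Lagrangian orbit on $\mathbb{CP}^n$ if and only if $S^1\times K$ has a Lagrangian orbit on $\mathbb{C}^{n+1}$. -/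

import Mathlib

open scoped Manifold ContDiff LinearAlgebra.Projectivization Topology

noncomputable section

/-! ## Hamiltonian actions and Lagrangian orbits -/

/-- A smooth real Lie group has a Lie algebra (the instance that Mathlib's bracket asks for). -/
instance lieGroup_minSmoothness_three {F H G : Type*} [NormedAddCommGroup F] [NormedSpace ℝ F]
    [TopologicalSpace H] {I : ModelWithCorners ℝ F H} [TopologicalSpace G] [ChartedSpace H G]
    [Group G] [LieGroup I ∞ G] : LieGroup I (minSmoothness ℝ 3) G := by
  rw [minSmoothness_of_isRCLikeNormedField]
  infer_instance

section Actions

variable {F H G : Type*} [NormedAddCommGroup F] [NormedSpace ℝ F] [TopologicalSpace H]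
  (I : ModelWithCorners ℝ F H) [TopologicalSpace G] [ChartedSpace H G] [Group G]
  {F' H' M : Type*} [NormedAddCommGroup F'] [NormedSpace ℝ F'] [TopologicalSpace H']
  (J : ModelWithCorners ℝ F' H') [TopologicalSpace M] [ChartedSpace H' M]

/-- A field of real bilinear forms on the tangent spaces of `M`. -/
abbrev FormField (M : Type*) [TopologicalSpace M] [ChartedSpace H' M] : Type _ :=
  ∀ x : M, LinearMap.BilinForm ℝ (TangentSpace J x)

/-- `a` is a smooth left action of the Lie group `G` on the manifold `M`. -/
structure IsSmoothAction (a : G → M → M) : Prop where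
  one_act : ∀ x, a 1 x = x
  mul_act : ∀ g h x, a (g * h) x = a g (a h x)
  smooth : ContMDiff (I.prod J) J ∞ (fun q : G × M => a q.1 q.2)

/-- The tangent space at `a g x` of the orbit of `x`: the range of the differential at `g` of the
orbit map `h ↦ a h x`. -/
def orbitTangent (a : G → M → M) (x : M) (g : G) : Submodule ℝ (TangentSpace J (a g x)) :=
  LinearMap.range (mfderiv I J (fun h : G => a h x) g).toLinearMap

/-- The orbit of `x` is Lagrangian: at each of its points its tangent space has half the dimension
of the manifold, and the form vanishes on it. -/
def IsLagrangianOrbit (Ω : FormField J M) (a : G → M → M) (x : M) : Prop :=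
  ∀ g : G,
    2 * Module.finrank ℝ (orbitTangent I J a x g) = Module.finrank ℝ (TangentSpace J (a g x)) ∧
    ∀ u ∈ orbitTangent I J a x g, ∀ v ∈ orbitTangent I J a x g, Ω (a g x) u v = 0

/-- The action admits a Lagrangian orbit. -/
def HasLagrangianOrbit (Ω : FormField J M) (a : G → M → M) : Prop :=
  ∃ x : M, IsLagrangianOrbit I J Ω a x

/-- The fundamental vector field of `X`, that is `d/dt a (exp (t X)) x` at `t = 0`: the differential
at `1` of the orbit map, applied to `X`. (The base point `a 1 x` is `x`.) -/
def fundamentalField (a : G → M → M) (X : GroupLieAlgebra I G) (x : M) : TangentSpace J x :=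
  (mfderiv I J (fun g : G => a g x) 1 X : TangentSpace J (a 1 x))

/-- The adjoint representation: the differential at `1` of `h ↦ g * h * g⁻¹`. -/
def groupAd (g : G) (X : GroupLieAlgebra I G) : GroupLieAlgebra I G :=
  (mfderiv I I (fun h : G => g * h * g⁻¹) 1 X : TangentSpace I (g * 1 * g⁻¹))

/-- `μ : M → 𝔤*` is a moment map: each component `μ^X` is a smooth function with
`dμ^X = Ω(X^#, ·)`, and `μ` is equivariant for the coadjoint action. -/
structure IsMomentMap (Ω : FormField J M) (a : G → M → M)
    (μ : M → Module.Dual ℝ (GroupLieAlgebra I G)) : Prop where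
  smooth : ∀ X, ContMDiff J 𝓘(ℝ, ℝ) ∞ (fun x => μ x X)
  hamiltonian : ∀ (X : GroupLieAlgebra I G) (x : M) (v : TangentSpace J x),
    (mfderiv J 𝓘(ℝ, ℝ) (fun y => μ y X) x v : ℝ) = Ω x (fundamentalField I J a X x) v
  equivariant : ∀ (g : G) (x : M) (X : GroupLieAlgebra I G),
    μ (a g x) X = μ x (groupAd I g⁻¹ X)

/-- The action is Hamiltonian: smooth, by symplectic diffeomorphisms, and with a moment map. -/
structure IsHamiltonianAction (Ω : FormField J M) (a : G → M → M) : Prop where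
  isSmoothAction : IsSmoothAction I J a
  symplectic : ∀ (g : G) (x : M) (u v : TangentSpace J x),
    Ω (a g x) (mfderiv J J (a g) x u) (mfderiv J J (a g) x v) = Ω x u v
  exists_momentMap : ∃ μ, IsMomentMap I J Ω a μ

end Actions

/-! ## The symplectic vector space `ℂ^m` -/

/-- `ℂ^m` with its standard Hermitian structure. -/
abbrev CSpace (m : ℕ) : Type := EuclideanSpace ℂ (Fin m)

/-- The standard symplectic form `∑ dx_j ∧ dy_j = Im ⟨u, v⟩` of `ℂ^m` (the inner product is
conjugate linear in the first variable). -/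
def stdForm (m : ℕ) : LinearMap.BilinForm ℝ (CSpace m) :=
  LinearMap.mk₂ ℝ (fun u v => (inner ℂ u v).im)
    (by intro u v w; simp)
    (by intro c u v; simp [← Complex.coe_smul, mul_comm])
    (by intro u v w; simp)
    (by intro c u v; simp [← Complex.coe_smul])

/-- The standard symplectic form on the manifold `ℂ^m`. -/
def stdFormField (m : ℕ) : FormField 𝓘(ℝ, CSpace m) (CSpace m) := fun _ => stdForm m

/-! ## Complex projective space -/

/-- `ℂP^n`, the space of complex lines in `ℂ^{n+1}`. -/
abbrev CProj (n : ℕ) : Type := ℙ ℂ (CSpace (n + 1))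

namespace CProj

variable {n : ℕ}

/-- The quotient topology of `ℂ^{n+1} \ {0} → ℂP^n`. -/
instance instTopologicalSpace : TopologicalSpace (CProj n) :=
  TopologicalSpace.coinduced (Projectivization.mk' ℂ) inferInstance

/-- The affine coordinates `(z_j / z_i)_{j ≠ i}` of a vector `z`. -/
def affineCoord (i : Fin (n + 1)) (z : CSpace (n + 1)) : CSpace n :=
  WithLp.toLp 2 fun j => z (i.succAbove j) / z i

/-- The linear map `ℂ^n → ℂ^{n+1}` that puts a zero in the place `i`. -/
def insertZero (i : Fin (n + 1)) : CSpace n →ₗ[ℝ] CSpace (n + 1) where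
  toFun w := WithLp.toLp 2 (i.insertNth (0 : ℂ) w : Fin (n + 1) → ℂ)
  map_add' u v := by
    ext k
    refine Fin.succAboveCases i ?_ (fun j => ?_) k <;> simp
  map_smul' c u := by
    ext k
    refine Fin.succAboveCases i ?_ (fun j => ?_) k <;> simp

/-- The vector with `1` in the place `i` and affine coordinates `w`. -/
def affineLift (i : Fin (n + 1)) (w : CSpace n) : CSpace (n + 1) :=
  WithLp.toLp 2 (i.insertNth (1 : ℂ) w : Fin (n + 1) → ℂ)

@[simp] lemma affineLift_same (i : Fin (n + 1)) (w : CSpace n) : affineLift i w i = 1 := by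
  simp [affineLift]

@[simp] lemma affineLift_succAbove (i : Fin (n + 1)) (w : CSpace n) (j : Fin n) :
    affineLift i w (i.succAbove j) = w j := by
  simp [affineLift]

lemma affineLift_ne_zero (i : Fin (n + 1)) (w : CSpace n) : affineLift i w ≠ 0 := by
  intro h
  have := congrArg (fun v : CSpace (n + 1) => v i) h
  simp at this

lemma isQuotientMap_mk' :
    Topology.IsQuotientMap (Projectivization.mk' ℂ : {v : CSpace (n + 1) // v ≠ 0} → CProj n) :=
  ⟨⟨rfl⟩, Quotient.mk''_surjective⟩

/-- The affine coordinates of a line. -/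
def chartFun (i : Fin (n + 1)) (ℓ : CProj n) : CSpace n :=
  Projectivization.lift (fun v : {v : CSpace (n + 1) // v ≠ 0} => affineCoord i v.1)
    (by
      rintro a b t h
      have ht : t ≠ 0 := by
        rintro rfl
        exact a.2 (by simpa using h)
      ext j
      simp [affineCoord, h, mul_div_mul_left _ _ ht]) ℓ

@[simp] lemma chartFun_mk (i : Fin (n + 1)) (v : CSpace (n + 1)) (hv : v ≠ 0) :
    chartFun i (Projectivization.mk ℂ v hv) = affineCoord i v := rfl

lemma rep_coord_ne_zero_iff (i : Fin (n + 1)) (v : CSpace (n + 1)) (hv : v ≠ 0) :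
    (Projectivization.mk ℂ v hv).rep i ≠ 0 ↔ v i ≠ 0 := by
  obtain ⟨a, ha⟩ := Projectivization.exists_smul_eq_mk_rep ℂ v hv
  rw [← ha]
  simp [Units.smul_def]

lemma isOpen_coord_ne_zero (i : Fin (n + 1)) : IsOpen {ℓ : CProj n | ℓ.rep i ≠ 0} := by
  rw [← isQuotientMap_mk'.isOpen_preimage]
  have : (Projectivization.mk' ℂ : {v : CSpace (n + 1) // v ≠ 0} → CProj n) ⁻¹'
      {ℓ : CProj n | ℓ.rep i ≠ 0} = {v | v.1 i ≠ 0} := by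
    ext v
    exact rep_coord_ne_zero_iff i v.1 v.2
  rw [this]
  exact isOpen_ne_fun (by fun_prop) continuous_const

/-- The affine chart `z_i ≠ 0`, with inverse `w ↦ [w_1 : … : 1 : … : w_n]`. -/
def affineChart (i : Fin (n + 1)) : OpenPartialHomeomorph (CProj n) (CSpace n) where
  toFun := chartFun i
  invFun w := Projectivization.mk ℂ (affineLift i w) (affineLift_ne_zero i w)
  source := {ℓ | ℓ.rep i ≠ 0}
  target := Set.univ
  map_source' _ _ := trivial
  map_target' w _ := by
    simp only [Set.mem_ofPred_eq, rep_coord_ne_zero_iff]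
    simp
  left_inv' ℓ := by
    induction ℓ using Projectivization.ind with
    | h v hv =>
      intro h
      simp only [Set.mem_ofPred_eq, rep_coord_ne_zero_iff] at h
      rw [chartFun_mk, Projectivization.mk_eq_mk_iff']
      refine ⟨(v i)⁻¹, ?_⟩
      ext k
      refine Fin.succAboveCases i ?_ (fun j => ?_) k
      · simp [h]
      · simp [affineCoord, div_eq_inv_mul]
  right_inv' w _ := by
    ext j
    simp [affineCoord]
  open_source := isOpen_coord_ne_zero i
  open_target := isOpen_univ
  continuousOn_toFun := by
    rw [isQuotientMap_mk'.continuousOn_isOpen_iff (isOpen_coord_ne_zero i)]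
    have h : ContinuousOn (fun v : {v : CSpace (n + 1) // v ≠ 0} => affineCoord i v.1)
        {v | v.1 i ≠ 0} := by
      refine (PiLp.continuous_toLp 2 _).comp_continuousOn (continuousOn_pi.2 fun j => ?_)
      exact ContinuousOn.div (by fun_prop) (by fun_prop) (fun v hv => hv)
    exact h.mono fun v hv => (rep_coord_ne_zero_iff i v.1 v.2).1 hv
  continuousOn_invFun := by
    refine Continuous.continuousOn ?_
    have h : Continuous (affineLift i : CSpace n → CSpace (n + 1)) := by
      refine (PiLp.continuous_toLp 2 _).comp (continuous_pi fun k => ?_)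
      refine Fin.succAboveCases i ?_ (fun j => ?_) k
      · simpa using continuous_const
      · simp only [Fin.insertNth_apply_succAbove]
        fun_prop
    exact isQuotientMap_mk'.continuous.comp (h.subtype_mk (affineLift_ne_zero i))

lemma exists_coord_ne_zero (ℓ : CProj n) : ∃ i, ℓ.rep i ≠ 0 := by
  by_contra! h
  exact ℓ.rep_nonzero (by ext i; simp [h i])

/-- The index of the affine chart that serves as preferred chart at the line `ℓ`. -/
def chartIndex (ℓ : CProj n) : Fin (n + 1) := (exists_coord_ne_zero ℓ).choose

/-- `ℂP^n` with its affine charts. -/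
instance instChartedSpace : ChartedSpace (CSpace n) (CProj n) where
  atlas := Set.range affineChart
  chartAt ℓ := affineChart (chartIndex ℓ)
  mem_chart_source ℓ := (exists_coord_ne_zero ℓ).choose_spec
  chart_mem_atlas ℓ := ⟨chartIndex ℓ, rfl⟩

/-- The affine charts make `ℂP^n` a smooth manifold, of real dimension `2n`. -/
instance instIsManifold : IsManifold 𝓘(ℝ, CSpace n) ∞ (CProj n) := by
  apply isManifold_of_contDiffOn
  rintro _ _ ⟨i, rfl⟩ ⟨i', rfl⟩
  have h1 : ∀ k, ContDiff ℝ ∞ (fun w : CSpace n => affineLift i w k) := by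
    intro k
    refine Fin.succAboveCases i ?_ (fun j => ?_) k
    · simpa using contDiff_const
    · simp only [affineLift_succAbove]
      fun_prop
  have h2 : ContDiffOn ℝ ∞ (fun w : CSpace n => affineCoord i' (affineLift i w))
      {w | affineLift i w i' ≠ 0} := by
    rw [contDiffOn_piLp]
    intro j
    simp only [affineCoord, div_eq_mul_inv]
    exact (h1 (i'.succAbove j)).contDiffOn.mul ((h1 i').contDiffOn.inv fun w hw => hw)
  refine h2.mono ?_
  rintro w ⟨hw, -⟩
  simp only [Set.mem_preimage, OpenPartialHomeomorph.trans_source] at hw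
  exact (rep_coord_ne_zero_iff i' _ (affineLift_ne_zero i w)).1 hw.2

/-- The Fubini–Study form in homogeneous coordinates at `p ≠ 0`, a form on `ℂ^{n+1}` with kernel
`ℂ p`; on the unit sphere it is the restriction of the standard symplectic form. -/
def homogeneousFubiniStudy (p : CSpace (n + 1)) : LinearMap.BilinForm ℝ (CSpace (n + 1)) :=
  LinearMap.mk₂ ℝ
    (fun u v => ((‖p‖ : ℂ) ^ 2 * inner ℂ u v - inner ℂ u p * inner ℂ p v).im / ‖p‖ ^ 4)
    (by intro u v w; simp only [inner_add_left, ← add_div, ← Complex.add_im]; ring_nf)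
    (by
      intro c u v
      rw [smul_eq_mul, ← mul_div_assoc, ← Complex.im_ofReal_mul]
      simp only [← Complex.coe_smul, inner_smul_left, Complex.conj_ofReal]; ring_nf)
    (by intro u v w; simp only [inner_add_right, ← add_div, ← Complex.add_im]; ring_nf)
    (by
      intro c u v
      rw [smul_eq_mul, ← mul_div_assoc, ← Complex.im_ofReal_mul]
      simp only [← Complex.coe_smul, inner_smul_right]; ring_nf)

/-- The Fubini–Study form on `ℂP^n`. A tangent vector at `ℓ` is a vector of `ℂ^n` in the preferred
affine chart at `ℓ`; it is lifted to `ℂ^{n+1}` by the differential `insertZero` of the section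
`affineLift` of that chart. -/
def fubiniStudy (n : ℕ) : FormField 𝓘(ℝ, CSpace n) (CProj n) := fun ℓ =>
  (homogeneousFubiniStudy (affineLift (chartIndex ℓ) (chartFun (chartIndex ℓ) ℓ))).compl₁₂
    (insertZero (chartIndex ℓ)) (insertZero (chartIndex ℓ))

end CProj

/-! ## The two actions defined by a linear representation -/

/-- The action on `ℂP^n` induced by a linear representation on `ℂ^{n+1}`. -/
def projAction {K : Type*} [Group K] {n : ℕ} (ρ : K →* (CSpace (n + 1) ≃ₗ[ℂ] CSpace (n + 1))) :
    K → CProj n → CProj n :=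
  fun k ℓ => ρ k • ℓ

/-- The action of `S¹ × K` on `ℂ^{n+1}`: `S¹` acts by scalars, `K` by the representation. -/
def circleAction {K : Type*} [Group K] {n : ℕ} (ρ : K →* (CSpace (n + 1) ≃ₗ[ℂ] CSpace (n + 1))) :
    Circle × K → CSpace (n + 1) → CSpace (n + 1) :=
  fun q v => (q.1 : ℂ) • ρ q.2 v

end

noncomputable section

/-! The representation turns out to be unitary, and for a unitary representation the cone over a
Lagrangian orbit is Lagrangian.

Unitarity: since `projAction ρ k` is symplectic, `ρ k` preserves the homogeneous Fubini–Study form.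
On the pair `(u, i u)` at `p` this form is the Gram determinant of `p` and `u` divided by `‖p‖ ^ 4`.
Exchanging `p` and `u` changes only the denominator, so preserving both values forces `ρ k` to
stretch `p` and `u` by the same factor (`norm_mul_norm_eq_of_homogeneousFubiniStudy`). Compactness
of `K` makes that factor 1 (`norm_map_eq_of_norm_mul_norm_eq`).

Comparison of orbits: the `S¹ × K`-orbit of `p ≠ 0` lies in a sphere, and its tangent space `T` at
`ρ g p` is spanned by `i ρ g p` and the tangent space of the `K`-orbit. Projection to `ℂP^n` maps
`T` onto the tangent space of the projective orbit with kernel exactly `ℝ i ρ g p`, so the dimension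
drops by one, as from `n + 1` to `n`. On vectors tangent to the sphere the standard form is `‖p‖ ^
2` times the pullback of the Fubini–Study form, so one tangent space is isotropic when the other is
(`lagrangian_iff_map_lineDeriv`). Points of the same orbit that differ by a unit scalar `z` are
related by a linear symplectic map. Finally, the origin has no Lagrangian orbit, so every Lagrangian
orbit upstairs has a projection. -/

namespace CProj

/-! ### The projection to projective space and its differential -/

variable {n : ℕ}

/-- The line spanned by a nonzero vector, extended to `ℂ^{n+1}` by an arbitrary value at `0`. -/
def lineOf (v : CSpace (n + 1)) : CProj n :=
  open Classical in
  if h : v ≠ 0 then Projectivization.mk ℂ v h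
  else Projectivization.mk ℂ (affineLift 0 0) (affineLift_ne_zero 0 0)

lemma lineOf_of_ne_zero {v : CSpace (n + 1)} (h : v ≠ 0) :
    lineOf v = Projectivization.mk ℂ v h := dif_pos h

lemma coord_chartIndex_lineOf_ne_zero {p : CSpace (n + 1)} (hp : p ≠ 0) :
    p (chartIndex (lineOf p)) ≠ 0 := by
  have h := (exists_coord_ne_zero (lineOf p)).choose_spec
  rw [← rep_coord_ne_zero_iff _ p hp, ← lineOf_of_ne_zero hp]
  exact h

lemma continuousAt_lineOf {p : CSpace (n + 1)} (hp : p ≠ 0) :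
    ContinuousAt (lineOf : CSpace (n + 1) → CProj n) p := by
  have ho : IsOpen {v : CSpace (n + 1) | v ≠ 0} := isOpen_ne
  have hc : ContinuousOn (lineOf : CSpace (n + 1) → CProj n) {v | v ≠ 0} := by
    rw [continuousOn_iff_continuous_domRestrict]
    convert! (isQuotientMap_mk' (n := n)).continuous using 1
    funext v
    exact lineOf_of_ne_zero v.2
  exact hc.continuousAt (ho.mem_nhds hp)

/-- The differential at `p` of the `i`-th affine coordinates. -/
def affineDeriv (i : Fin (n + 1)) (p : CSpace (n + 1)) : CSpace (n + 1) →L[ℝ] CSpace n :=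
  LinearMap.toContinuousLinearMap
    { toFun := fun u => WithLp.toLp 2 fun j =>
        (p i)⁻¹ * (u (i.succAbove j) - u i / p i * p (i.succAbove j))
      map_add' := by intro u v; ext j; simp; ring
      map_smul' := by intro c u; ext j; simp; ring }

lemma affineDeriv_apply (i : Fin (n + 1)) (p u : CSpace (n + 1)) (j : Fin n) :
    affineDeriv i p u j = (p i)⁻¹ * (u (i.succAbove j) - u i / p i * p (i.succAbove j)) := rfl

lemma hasFDerivAt_affineCoord (i : Fin (n + 1)) {p : CSpace (n + 1)} (hp : p i ≠ 0) :
    HasFDerivAt (affineCoord i) (affineDeriv i p) p := by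
  rw [← hasFDerivWithinAt_univ, hasFDerivWithinAt_piLp]
  intro j
  have hk : ∀ k, HasFDerivAt (fun v : CSpace (n + 1) => v k)
      ((EuclideanSpace.proj k : CSpace (n + 1) →L[ℂ] ℂ).restrictScalars ℝ) p := fun k =>
    ((EuclideanSpace.proj k : CSpace (n + 1) →L[ℂ] ℂ).restrictScalars ℝ).hasFDerivAt
  have h := (hk (i.succAbove j)).mul
    ((hasDerivAt_inv hp).hasFDerivAt.restrictScalars ℝ |>.comp p (hk i))
  refine (h.congr_fderiv ?_).hasFDerivWithinAt
  ext u
  simp [affineDeriv_apply]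
  field_simp
  ring

/-- Passing to the chart and lifting back alters `u` only by the scalar `(p i)⁻¹` and a multiple of
`p`, the two changes that the homogeneous form does not see. -/
lemma insertZero_affineDeriv (i : Fin (n + 1)) {p : CSpace (n + 1)} (hp : p i ≠ 0)
    (u : CSpace (n + 1)) :
    insertZero i (affineDeriv i p u) = (p i)⁻¹ • (u - (u i / p i) • p) := by
  ext k
  refine Fin.succAboveCases i ?_ (fun j => ?_) k
  · simp [insertZero, hp]
  · simp [insertZero, affineDeriv_apply]

lemma affineLift_affineCoord (i : Fin (n + 1)) {p : CSpace (n + 1)} (hp : p i ≠ 0) :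
    affineLift i (affineCoord i p) = (p i)⁻¹ • p := by
  ext k
  refine Fin.succAboveCases i ?_ (fun j => ?_) k
  · simp [hp]
  · simp [affineCoord, div_eq_inv_mul]

lemma homogeneousFubiniStudy_apply (p u v : CSpace (n + 1)) :
    homogeneousFubiniStudy p u v =
      ((‖p‖ : ℂ) ^ 2 * inner ℂ u v - inner ℂ u p * inner ℂ p v).im / ‖p‖ ^ 4 := rfl

/-- The line `ℂ p` is in the kernel of the form at `p`, and a common factor `a` multiplies numerator
and denominator by `‖a‖ ^ 4`. Hence the form descends to `ℂP^n`. -/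
lemma homogeneousFubiniStudy_smul_sub (p u v : CSpace (n + 1)) {a : ℂ} (ha : a ≠ 0) (c c' : ℂ) :
    homogeneousFubiniStudy (a • p) (a • (u - c • p)) (a • (v - c' • p)) =
      homogeneousFubiniStudy p u v := by
  have hpp : inner ℂ p p = (‖p‖ : ℂ) ^ 2 := inner_self_eq_norm_sq_to_K p
  have haa : (starRingEnd ℂ) a * a = (‖a‖ : ℂ) ^ 2 := Complex.conj_mul' a
  have key : ((‖a • p‖ : ℂ) ^ 2 * inner ℂ (a • (u - c • p)) (a • (v - c' • p)) -
        inner ℂ (a • (u - c • p)) (a • p) * inner ℂ (a • p) (a • (v - c' • p))) =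
      ((‖a‖ ^ 4 : ℝ) : ℂ) * ((‖p‖ : ℂ) ^ 2 * inner ℂ u v - inner ℂ u p * inner ℂ p v) := by
    simp only [inner_smul_left, inner_smul_right, inner_sub_left, inner_sub_right, hpp, norm_smul]
    push_cast
    have h4 : (‖a‖ : ℂ) ^ 4 = ((starRingEnd ℂ) a * a) ^ 2 := by rw [haa]; ring
    rw [h4, mul_pow, ← haa]
    ring
  rw [homogeneousFubiniStudy_apply, homogeneousFubiniStudy_apply, key, Complex.im_ofReal_mul,
    norm_smul, mul_pow, mul_div_mul_left]
  exact pow_ne_zero _ (norm_ne_zero_iff.2 ha)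

/-- The differential at `p ≠ 0` of the projection `ℂ^{n+1} \ {0} → ℂP^n`. -/
def lineDeriv (p : CSpace (n + 1)) : CSpace (n + 1) →L[ℝ] CSpace n :=
  affineDeriv (chartIndex (lineOf p)) p

/-- In the preferred chart at `lineOf p` the projection is `affineCoord` away from the origin, so
the arbitrary value at `0` plays no role. -/
lemma hasMFDerivAt_lineOf {p : CSpace (n + 1)} (hp : p ≠ 0) :
    HasMFDerivAt 𝓘(ℝ, CSpace (n + 1)) 𝓘(ℝ, CSpace n) (lineOf : CSpace (n + 1) → CProj n) p
      (lineDeriv p) := by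
  refine ⟨continuousAt_lineOf hp, ?_⟩
  have h := hasFDerivAt_affineCoord _ (coord_chartIndex_lineOf_ne_zero hp)
  have ho : IsOpen {v : CSpace (n + 1) | v ≠ 0} := isOpen_ne
  refine HasFDerivAt.hasFDerivWithinAt (h.congr_of_eventuallyEq ?_)
  filter_upwards [ho.mem_nhds hp] with v hv
  change chartFun (chartIndex (lineOf p)) (lineOf v) = _
  rw [lineOf_of_ne_zero hv, chartFun_mk]

/-- This frees the Fubini–Study form from its chart: any representative `p` of the line and any
lifts of the tangent vectors may be used. -/
lemma fubiniStudy_lineDeriv {p : CSpace (n + 1)} (hp : p ≠ 0) (u v : CSpace (n + 1)) :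
    fubiniStudy n (lineOf p) (lineDeriv p u) (lineDeriv p v) = homogeneousFubiniStudy p u v := by
  have hi := coord_chartIndex_lineOf_ne_zero hp
  have hc : chartFun (chartIndex (lineOf p)) (lineOf p) =
      affineCoord (chartIndex (lineOf p)) p := by
    conv_lhs => rw [lineOf_of_ne_zero hp, chartFun_mk, ← lineOf_of_ne_zero hp]
  change homogeneousFubiniStudy (affineLift _ (chartFun _ (lineOf p)))
    (insertZero _ (affineDeriv _ p u)) (insertZero _ (affineDeriv _ p v)) = _
  rw [hc, affineLift_affineCoord _ hi, insertZero_affineDeriv _ hi, insertZero_affineDeriv _ hi,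
    homogeneousFubiniStudy_smul_sub _ _ _ (inv_ne_zero hi)]

lemma lineDeriv_smul_self (p : CSpace (n + 1)) (c : ℂ) (hp : p ≠ 0) :
    lineDeriv p (c • p) = 0 := by
  have hi := coord_chartIndex_lineOf_ne_zero hp
  ext j
  simp [lineDeriv, affineDeriv_apply, hi]

lemma exists_eq_smul_of_lineDeriv_eq_zero {p u : CSpace (n + 1)} (hp : p ≠ 0)
    (h : lineDeriv p u = 0) : ∃ c : ℂ, u = c • p := by
  have hi := coord_chartIndex_lineOf_ne_zero hp
  have h' := insertZero_affineDeriv _ hi u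
  change insertZero _ (lineDeriv p u) = _ at h'
  rw [h, map_zero] at h'
  exact ⟨_, sub_eq_zero.1 ((smul_eq_zero.1 h'.symm).resolve_left (inv_ne_zero hi))⟩

end CProj

/-! ## The algebra of Lagrangian subspaces under projection -/

open CProj

variable {n : ℕ}

lemma stdForm_apply (m : ℕ) (u v : CSpace m) : stdForm m u v = (inner ℂ u v).im := rfl

/-- Both inner products with `p` are purely imaginary, so their product is real and the correction
term drops out of the imaginary part. -/
lemma homogeneousFubiniStudy_of_tangent_sphere {p u v : CSpace (n + 1)} (hp : p ≠ 0)
    (hu : (inner ℂ p u).re = 0) (hv : (inner ℂ p v).re = 0) :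
    homogeneousFubiniStudy p u v = stdForm (n + 1) u v / ‖p‖ ^ 2 := by
  have h0 : ‖p‖ ≠ 0 := norm_ne_zero_iff.2 hp
  have hu' : (inner ℂ u p).re = 0 := by rw [← inner_conj_symm, Complex.conj_re, hu]
  have h2 : ((‖p‖ : ℂ) ^ 2 * inner ℂ u v).im = ‖p‖ ^ 2 * (inner ℂ u v).im := by
    rw [← Complex.ofReal_pow, Complex.im_ofReal_mul]
  rw [homogeneousFubiniStudy_apply, stdForm_apply, Complex.sub_im, h2, Complex.mul_im, hu', hv]
  field_simp
  ring

/-- A real subspace `T ∋ i p` of the tangent space of the sphere through `p` is Lagrangian in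
`ℂ^{n+1}` if and only if its image in the tangent space of `ℂP^n` is Lagrangian. -/
lemma lagrangian_iff_map_lineDeriv {p : CSpace (n + 1)} (hp : p ≠ 0)
    (T : Submodule ℝ (CSpace (n + 1))) (hT : ∀ u ∈ T, (inner ℂ p u).re = 0)
    (hpT : Complex.I • p ∈ T) :
    (2 * Module.finrank ℝ T = Module.finrank ℝ (CSpace (n + 1)) ∧
      ∀ u ∈ T, ∀ v ∈ T, stdForm (n + 1) u v = 0) ↔
    (2 * Module.finrank ℝ (T.map (lineDeriv p).toLinearMap) = Module.finrank ℝ (CSpace n) ∧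
      ∀ u ∈ T.map (lineDeriv p).toLinearMap, ∀ v ∈ T.map (lineDeriv p).toLinearMap,
        fubiniStudy n (lineOf p) u v = 0) := by
  have h0 : ‖p‖ ≠ 0 := norm_ne_zero_iff.2 hp
  have hdim : ∀ m, Module.finrank ℝ (CSpace m) = 2 * m := fun m => by
    rw [finrank_real_of_complex, finrank_euclideanSpace_fin]
  -- The kernel of the full differential is `ℂ p`; tangency to the sphere leaves only imaginary
  -- multiples of `p`.
  have hker : LinearMap.ker ((lineDeriv p).toLinearMap.domRestrict T) =
      Submodule.span ℝ {(⟨Complex.I • p, hpT⟩ : T)} := by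
    ext ⟨u, hu⟩
    rw [LinearMap.mem_ker, Submodule.mem_span_singleton]
    constructor
    · intro h
      obtain ⟨c, rfl⟩ := exists_eq_smul_of_lineDeriv_eq_zero hp h
      have hre := hT _ hu
      have hpp : inner ℂ p p = (‖p‖ : ℂ) ^ 2 := inner_self_eq_norm_sq_to_K p
      rw [inner_smul_right, hpp, ← Complex.ofReal_pow, Complex.re_mul_ofReal] at hre
      have hc : c.re = 0 := (mul_eq_zero.1 hre).resolve_right (pow_ne_zero 2 h0)
      refine ⟨c.im, Subtype.ext ?_⟩
      change c.im • Complex.I • p = c • p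
      rw [← Complex.coe_smul, smul_smul]
      congr 1
      apply Complex.ext <;> simp [hc]
    · rintro ⟨a, ha⟩
      have : u = ((a : ℂ) * Complex.I) • p := by
        rw [← smul_smul, Complex.coe_smul]
        exact (congrArg Subtype.val ha).symm
      subst this
      exact lineDeriv_smul_self p _ hp
  have hrank : Module.finrank ℝ T = Module.finrank ℝ (T.map (lineDeriv p).toLinearMap) + 1 := by
    have h := LinearMap.finrank_range_add_finrank_ker ((lineDeriv p).toLinearMap.domRestrict T)
    rw [hker, LinearMap.range_domRestrict, finrank_span_singleton] at h
    · exact h.symm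
    · intro h
      have := congrArg Subtype.val h
      exact (smul_ne_zero Complex.I_ne_zero hp) this
  rw [hdim, hdim, hrank]
  refine and_congr (by omega) ?_
  have hform : ∀ u ∈ T, ∀ v ∈ T, fubiniStudy n (lineOf p) (lineDeriv p u) (lineDeriv p v) =
      stdForm (n + 1) u v / ‖p‖ ^ 2 := fun u hu v hv => by
    rw [fubiniStudy_lineDeriv hp, homogeneousFubiniStudy_of_tangent_sphere hp (hT u hu) (hT v hv)]
  constructor
  · rintro h _ ⟨u, hu, rfl⟩ _ ⟨v, hv, rfl⟩
    exact (hform u hu v hv).trans (by rw [h u hu v hv, zero_div])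
  · intro h u hu v hv
    have := (hform u hu v hv).symm.trans (h _ ⟨u, hu, rfl⟩ _ ⟨v, hv, rfl⟩)
    exact (div_eq_zero_iff.1 this).resolve_right (pow_ne_zero 2 h0)

/-! ## Linear maps that preserve the Fubini–Study form -/

lemma homogeneousFubiniStudy_I_smul (p u : CSpace (n + 1)) :
    homogeneousFubiniStudy p u (Complex.I • u) =
      (‖p‖ ^ 2 * ‖u‖ ^ 2 - ‖inner ℂ u p‖ ^ 2) / ‖p‖ ^ 4 := by
  have huu : inner ℂ u u = (‖u‖ : ℂ) ^ 2 := inner_self_eq_norm_sq_to_K u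
  have hup : inner ℂ u p * inner ℂ p u = (‖inner ℂ u p‖ : ℂ) ^ 2 := by
    rw [← inner_conj_symm p u, Complex.mul_conj']
  rw [homogeneousFubiniStudy_apply]
  congr 1
  have : (‖p‖ : ℂ) ^ 2 * inner ℂ u (Complex.I • u) - inner ℂ u p * inner ℂ p (Complex.I • u) =
      ((‖p‖ ^ 2 * ‖u‖ ^ 2 - ‖inner ℂ u p‖ ^ 2 : ℝ) : ℂ) * Complex.I := by
    push_cast
    rw [inner_smul_right, inner_smul_right, huu, ← hup]
    ring
  rw [this, Complex.im_ofReal_mul, Complex.I_im, mul_one]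

/-- A linear automorphism that preserves the Fubini–Study form scales all norms alike. -/
lemma norm_mul_norm_eq_of_homogeneousFubiniStudy (A : CSpace (n + 1) ≃ₗ[ℂ] CSpace (n + 1))
    (hA : ∀ p, p ≠ 0 → ∀ u v,
      homogeneousFubiniStudy (A p) (A u) (A v) = homogeneousFubiniStudy p u v)
    {p u : CSpace (n + 1)} (hp : p ≠ 0) :
    ‖A u‖ * ‖p‖ = ‖A p‖ * ‖u‖ := by
  by_cases hdep : ∃ c : ℂ, u = c • p
  · obtain ⟨c, rfl⟩ := hdep
    rw [map_smul, norm_smul, norm_smul]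
    ring
  have hu : u ≠ 0 := fun h => hdep ⟨0, by simp [h]⟩
  have hAp : A p ≠ 0 := (LinearEquiv.map_ne_zero_iff A).2 hp
  have hAu : A u ≠ 0 := (LinearEquiv.map_ne_zero_iff A).2 hu
  have hlt : ‖inner ℂ u p‖ < ‖u‖ * ‖p‖ := by
    refine lt_of_le_of_ne (norm_inner_le_norm u p) fun h => hdep ?_
    have h' : ‖inner ℂ p u‖ = ‖p‖ * ‖u‖ := by rw [norm_inner_symm, h, mul_comm]
    obtain ⟨c, -, hc⟩ := (norm_inner_eq_norm_iff hp hu).1 h'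
    exact ⟨c, hc⟩
  -- Two values with the same Gram determinant in the numerator, over `‖p‖ ^ 4` and over `‖u‖ ^ 4`;
  -- comparing them cancels the determinants of both pairs.
  have h1 := hA p hp u (Complex.I • u)
  have h2 := hA u hu p (Complex.I • p)
  rw [map_smul, homogeneousFubiniStudy_I_smul, homogeneousFubiniStudy_I_smul] at h1 h2
  rw [norm_inner_symm, norm_inner_symm p u] at h2
  have n1 := norm_pos_iff.2 hp
  have n2 := norm_pos_iff.2 hu
  have n3 := norm_pos_iff.2 hAp
  have n4 := norm_pos_iff.2 hAu
  -- Strict Cauchy–Schwarz, from the linear independence of `p` and `u`.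
  have hG : 0 < ‖p‖ ^ 2 * ‖u‖ ^ 2 - ‖inner ℂ u p‖ ^ 2 := by
    have := pow_lt_pow_left₀ hlt (norm_nonneg _) two_ne_zero
    rw [mul_pow] at this
    linarith
  rw [div_eq_div_iff (by positivity) (by positivity)] at h1 h2
  have h3 : (‖A u‖ * ‖p‖) ^ 4 = (‖A p‖ * ‖u‖) ^ 4 := by
    set G := ‖p‖ ^ 2 * ‖u‖ ^ 2 - ‖inner ℂ u p‖ ^ 2
    have h4 : ‖u‖ ^ 2 * ‖p‖ ^ 2 - ‖inner ℂ u p‖ ^ 2 = G := by simp only [G]; ring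
    rw [h4] at h2
    set G' := ‖A p‖ ^ 2 * ‖A u‖ ^ 2 - ‖inner ℂ (A u) (A p)‖ ^ 2
    have h5 : ‖A u‖ ^ 2 * ‖A p‖ ^ 2 - ‖inner ℂ (A u) (A p)‖ ^ 2 = G' := by simp only [G']; ring
    rw [h5] at h2
    have hG' : G' ≠ 0 := by
      rintro h
      rw [h, zero_mul] at h1
      exact (mul_pos hG (pow_pos n3 4)).ne h1
    apply mul_left_cancel₀ (mul_ne_zero hG.ne' hG')
    linear_combination (G * ‖A u‖ ^ 4) * h1 - (G * ‖A p‖ ^ 4) * h2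
  exact (pow_left_inj₀ (by positivity) (by positivity) four_ne_zero).1 h3

/-! ## Representations whose projective action is symplectic -/

section Representation

lemma real_inner_eq_re_complex_inner {m : ℕ} (u v : CSpace m) :
    (inner ℝ u v : ℝ) = (inner ℂ u v : ℂ).re := by
  simp [PiLp.inner_apply, Complex.inner, Complex.mul_re, mul_comm]

lemma projAction_lineOf {n : ℕ} {K : Type*} [Group K]
    {ρ : K →* (CSpace (n + 1) ≃ₗ[ℂ] CSpace (n + 1))} (k : K) {p : CSpace (n + 1)} (hp : p ≠ 0) :
    projAction ρ k (lineOf p) = lineOf (ρ k p) := by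
  rw [lineOf_of_ne_zero hp, lineOf_of_ne_zero ((LinearEquiv.map_ne_zero_iff (ρ k)).2 hp)]
  rfl

variable {n d : ℕ} {K : Type*} [Group K] {ρ : K →* (CSpace (n + 1) ≃ₗ[ℂ] CSpace (n + 1))}

/-- Chain rule for `projAction ρ k ∘ lineOf = lineOf ∘ ρ k`, which holds off the origin and so near
`p`. -/
lemma mfderiv_projAction_lineDeriv (k : K)
    (hk : MDifferentiable 𝓘(ℝ, CSpace n) 𝓘(ℝ, CSpace n) (projAction ρ k))
    {p : CSpace (n + 1)} (hp : p ≠ 0) (u : CSpace (n + 1)) :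
    mfderiv 𝓘(ℝ, CSpace n) 𝓘(ℝ, CSpace n) (projAction ρ k) (lineOf p) (lineDeriv p u) =
      lineDeriv (ρ k p) (ρ k u) := by
  have hkp : ρ k p ≠ 0 := (LinearEquiv.map_ne_zero_iff (ρ k)).2 hp
  let A : CSpace (n + 1) →L[ℝ] CSpace (n + 1) :=
    (LinearMap.toContinuousLinearMap (ρ k).toLinearMap).restrictScalars ℝ
  have h1 := (hk (lineOf p)).hasMFDerivAt.comp p (hasMFDerivAt_lineOf hp)
  have h2 : HasMFDerivAt 𝓘(ℝ, CSpace (n + 1)) 𝓘(ℝ, CSpace n) (lineOf ∘ A) p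
      ((lineDeriv (ρ k p)).comp A) :=
    (hasMFDerivAt_lineOf hkp).comp p A.hasMFDerivAt
  have ho : IsOpen {v : CSpace (n + 1) | v ≠ 0} := isOpen_ne
  have h3 := hasMFDerivAt_unique (h1.congr_of_eventuallyEq (f₁ := lineOf ∘ A) (by
    filter_upwards [ho.mem_nhds hp] with v hv
    exact (projAction_lineOf k hv).symm)) h2
  exact congrArg (fun L : CSpace (n + 1) →L[ℝ] CSpace n => L u) h3

/-- All tangent spaces are `CSpace n` by definition, so the base point can be replaced by an equal
one without transporting the vectors. -/
lemma fubiniStudy_congr {ℓ ℓ' : CProj n} (h : ℓ = ℓ') (u v : CSpace n) :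
    (fubiniStudy n ℓ : LinearMap.BilinForm ℝ (CSpace n)) u v =
      (fubiniStudy n ℓ' : LinearMap.BilinForm ℝ (CSpace n)) u v := by
  subst h; rfl

lemma homogeneousFubiniStudy_map (k : K)
    (hk : MDifferentiable 𝓘(ℝ, CSpace n) 𝓘(ℝ, CSpace n) (projAction ρ k))
    (hs : ∀ (x : CProj n) (u v : TangentSpace 𝓘(ℝ, CSpace n) x),
      fubiniStudy n (projAction ρ k x)
        (mfderiv 𝓘(ℝ, CSpace n) 𝓘(ℝ, CSpace n) (projAction ρ k) x u)
        (mfderiv 𝓘(ℝ, CSpace n) 𝓘(ℝ, CSpace n) (projAction ρ k) x v) = fubiniStudy n x u v)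
    {p : CSpace (n + 1)} (hp : p ≠ 0) (u v : CSpace (n + 1)) :
    homogeneousFubiniStudy (ρ k p) (ρ k u) (ρ k v) = homogeneousFubiniStudy p u v := by
  have hkp : ρ k p ≠ 0 := (LinearEquiv.map_ne_zero_iff (ρ k)).2 hp
  rw [← fubiniStudy_lineDeriv hp, ← fubiniStudy_lineDeriv hkp]
  have h := hs (lineOf p) (lineDeriv p u) (lineDeriv p v)
  rw [mfderiv_projAction_lineDeriv k hk hp, mfderiv_projAction_lineDeriv k hk hp] at h
  exact (fubiniStudy_congr (projAction_lineOf k hp) _ _).symm.trans h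

variable [TopologicalSpace K] [ChartedSpace (EuclideanSpace ℝ (Fin d)) K]

/-- A continuous representation of a compact group that scales norms is unitary. -/
lemma norm_map_eq_of_norm_mul_norm_eq [CompactSpace K]
    (hc : ∀ p, Continuous fun k => ρ k p)
    (hρ : ∀ k p u, p ≠ 0 → ‖ρ k u‖ * ‖p‖ = ‖ρ k p‖ * ‖u‖) (k : K) (v : CSpace (n + 1)) :
    ‖ρ k v‖ = ‖v‖ := by
  by_cases hv : v = 0
  · simp [hv]
  have hv' := norm_pos_iff.2 hv
  have hle : ∀ k, ‖ρ k v‖ ≤ ‖v‖ := by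
    intro k
    -- At a `k₀` that maximises `‖ρ k₀ v‖`, a further `ρ k` cannot increase the norm, so its common
    -- stretching factor is at most 1.
    obtain ⟨k₀, -, h₀⟩ := isCompact_univ.exists_isMaxOn ⟨(1 : K), trivial⟩
      (hc v).norm.continuousOn
    have h1 : ‖ρ (k * k₀) v‖ ≤ ‖ρ k₀ v‖ := h₀ (Set.mem_univ (k * k₀))
    have h2 := hρ k v (ρ k₀ v) hv
    have hpos : 0 < ‖ρ k₀ v‖ := norm_pos_iff.2 ((LinearEquiv.map_ne_zero_iff (ρ k₀)).2 hv)
    rw [map_mul, LinearEquiv.mul_apply] at h1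
    refine le_of_mul_le_mul_right ?_ hpos
    rw [← h2, mul_comm ‖v‖]
    exact mul_le_mul_of_nonneg_right h1 hv'.le
  refine le_antisymm (hle k) ?_
  -- The factors of `k` and `k⁻¹` are reciprocal and both at most 1.
  have h1 := hρ k v (ρ k⁻¹ v) hv
  rw [← LinearEquiv.mul_apply, ← map_mul, mul_inv_cancel, map_one] at h1
  change ‖v‖ * ‖v‖ = _ at h1
  have h2 := mul_le_mul_of_nonneg_left (hle k⁻¹) (norm_nonneg (ρ k v))
  rw [← h1] at h2
  exact le_of_mul_le_mul_right h2 hv'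

lemma norm_map_eq_of_isHamiltonianAction [CompactSpace K]
    (hρ : ContMDiff ((𝓡 d).prod 𝓘(ℝ, CSpace (n + 1))) 𝓘(ℝ, CSpace (n + 1)) ∞
      (fun q : K × CSpace (n + 1) => ρ q.1 q.2))
    (hK : IsHamiltonianAction (𝓡 d) 𝓘(ℝ, CSpace n) (fubiniStudy n) (projAction ρ))
    (k : K) (v : CSpace (n + 1)) : ‖ρ k v‖ = ‖v‖ := by
  refine norm_map_eq_of_norm_mul_norm_eq (fun p => ?_) (fun k p u hp => ?_) k v
  · exact hρ.continuous.comp (continuous_id.prodMk continuous_const)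
  · have hk : ContMDiff 𝓘(ℝ, CSpace n) 𝓘(ℝ, CSpace n) ∞ (projAction ρ k) :=
      hK.isSmoothAction.smooth.comp (contMDiff_const.prodMk contMDiff_id)
    exact norm_mul_norm_eq_of_homogeneousFubiniStudy (ρ k) (fun p hp u v =>
      homogeneousFubiniStudy_map k (hk.mdifferentiable (by simp)) (hK.symplectic k) hp u v) hp

/-! ## Tangent spaces of the orbits -/

/-- The differential at `g` of the orbit map of `p` in `ℂ^{n+1}`, between model spaces. -/
def orbitMapDeriv (d : ℕ) [ChartedSpace (EuclideanSpace ℝ (Fin d)) K]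
    (ρ : K →* (CSpace (n + 1) ≃ₗ[ℂ] CSpace (n + 1))) (p : CSpace (n + 1)) (g : K) :
    EuclideanSpace ℝ (Fin d) →L[ℝ] CSpace (n + 1) :=
  mfderiv (𝓡 d) 𝓘(ℝ, CSpace (n + 1)) (fun h : K => ρ h p) g

/-- The differential at `z` of the inclusion of the circle in `ℂ`, between model spaces. -/
def circleCoeDeriv (z : Circle) : EuclideanSpace ℝ (Fin 1) →L[ℝ] ℂ :=
  mfderiv (𝓡 1) 𝓘(ℝ, ℂ) (fun w : Circle => (w : ℂ)) z

/-- The tangent space at `ρ g p` of the `K`-orbit of `p` in `ℂ^{n+1}`. -/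
def linearOrbitTangent (d : ℕ) [ChartedSpace (EuclideanSpace ℝ (Fin d)) K]
    (ρ : K →* (CSpace (n + 1) ≃ₗ[ℂ] CSpace (n + 1))) (p : CSpace (n + 1)) (g : K) :
    Submodule ℝ (CSpace (n + 1)) :=
  LinearMap.range (orbitMapDeriv d ρ p g).toLinearMap

/-- The tangent space at `ρ g p` of the orbit of `p` under `S¹ × K`. -/
def coneOrbitTangent (d : ℕ) [ChartedSpace (EuclideanSpace ℝ (Fin d)) K]
    (ρ : K →* (CSpace (n + 1) ≃ₗ[ℂ] CSpace (n + 1))) (p : CSpace (n + 1)) (g : K) :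
    Submodule ℝ (CSpace (n + 1)) :=
  Submodule.span ℝ {Complex.I • ρ g p} ⊔ linearOrbitTangent d ρ p g

lemma contMDiff_orbitMap
    (hρ : ContMDiff ((𝓡 d).prod 𝓘(ℝ, CSpace (n + 1))) 𝓘(ℝ, CSpace (n + 1)) ∞
      (fun q : K × CSpace (n + 1) => ρ q.1 q.2)) (p : CSpace (n + 1)) :
    ContMDiff (𝓡 d) 𝓘(ℝ, CSpace (n + 1)) ∞ (fun h : K => ρ h p) :=
  hρ.comp (contMDiff_id.prodMk contMDiff_const)

/-- Differentiate the constant function `‖ρ h p‖ ^ 2` of `h`. -/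
lemma re_inner_eq_zero_of_mem_linearOrbitTangent {p : CSpace (n + 1)} {g : K}
    (hΦ : MDifferentiableAt (𝓡 d) 𝓘(ℝ, CSpace (n + 1)) (fun h : K => ρ h p) g)
    (hu : ∀ k : K, ‖ρ k p‖ = ‖p‖) {u : CSpace (n + 1)} (h : u ∈ linearOrbitTangent d ρ p g) :
    (inner ℂ (ρ g p) u).re = 0 := by
  obtain ⟨X, rfl⟩ := h
  have h1 := (hasStrictFDerivAt_norm_sq (ρ g p)).hasFDerivAt.hasMFDerivAt.comp g hΦ.hasMFDerivAt
  have h2 : ((fun x : CSpace (n + 1) => ‖x‖ ^ 2) ∘ fun h : K => ρ h p) = fun _ => ‖p‖ ^ 2 := by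
    funext k
    simp [hu]
  rw [h2] at h1
  have h3 := hasMFDerivAt_unique h1 (hasMFDerivAt_const (‖p‖ ^ 2) g)
  have h4 : (2 : ℕ) • (inner ℝ (ρ g p) (orbitMapDeriv d ρ p g X) : ℝ) = 0 :=
    congrArg (fun L : EuclideanSpace ℝ (Fin d) →L[ℝ] ℝ => L X) h3
  exact (real_inner_eq_re_complex_inner _ _).symm.trans
    ((smul_eq_zero.1 h4).resolve_left two_ne_zero)

lemma re_inner_eq_zero_of_mem_coneOrbitTangent {p : CSpace (n + 1)} {g : K}
    (hΦ : MDifferentiableAt (𝓡 d) 𝓘(ℝ, CSpace (n + 1)) (fun h : K => ρ h p) g)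
    (hu : ∀ k : K, ‖ρ k p‖ = ‖p‖) {u : CSpace (n + 1)} (h : u ∈ coneOrbitTangent d ρ p g) :
    (inner ℂ (ρ g p) u).re = 0 := by
  obtain ⟨v, hv, w, hw, rfl⟩ := Submodule.mem_sup.1 h
  obtain ⟨a, rfl⟩ := Submodule.mem_span_singleton.1 hv
  have hqq : inner ℂ (ρ g p) (ρ g p) = (‖ρ g p‖ : ℂ) ^ 2 := inner_self_eq_norm_sq_to_K _
  rw [inner_add_right, Complex.add_re, re_inner_eq_zero_of_mem_linearOrbitTangent hΦ hu hw,
    ← Complex.coe_smul, inner_smul_right, inner_smul_right, hqq, ← Complex.ofReal_pow]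
  simp [-Complex.ofReal_pow]

/-- The circle direction `i ρ g p` lies in the kernel of the projection. -/
lemma map_lineDeriv_coneOrbitTangent {p : CSpace (n + 1)} (hp : p ≠ 0) (g : K) :
    (coneOrbitTangent d ρ p g).map (lineDeriv (ρ g p)).toLinearMap =
      (linearOrbitTangent d ρ p g).map (lineDeriv (ρ g p)).toLinearMap := by
  have h : (lineDeriv (ρ g p)).toLinearMap (Complex.I • ρ g p) = 0 :=
    lineDeriv_smul_self _ _ ((LinearEquiv.map_ne_zero_iff (ρ g)).2 hp)
  rw [coneOrbitTangent, Submodule.map_sup, Submodule.map_span, Set.image_singleton, h]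
  simp

lemma orbitTangent_projAction {p : CSpace (n + 1)} (hp : p ≠ 0) {g : K}
    (hΦ : MDifferentiableAt (𝓡 d) 𝓘(ℝ, CSpace (n + 1)) (fun h : K => ρ h p) g) :
    orbitTangent (𝓡 d) 𝓘(ℝ, CSpace n) (projAction ρ) (lineOf p) g =
      (linearOrbitTangent d ρ p g).map (lineDeriv (ρ g p)).toLinearMap := by
  have h1 := (hasMFDerivAt_lineOf ((LinearEquiv.map_ne_zero_iff (ρ g)).2 hp)).comp g
    hΦ.hasMFDerivAt
  have h2 : (lineOf ∘ fun h : K => ρ h p) = fun h => projAction ρ h (lineOf p) := by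
    funext h
    exact (projAction_lineOf h hp).symm
  rw [h2] at h1
  rw [orbitTangent, h1.mfderiv]
  exact LinearMap.range_comp _ _

/-- The tangent line of the circle at `z` is `ℝ i z`. -/
lemma range_circleCoeDeriv (z : Circle) :
    LinearMap.range (circleCoeDeriv z).toLinearMap = Submodule.span ℝ {(z : ℂ) * Complex.I} := by
  have hc : ContMDiff (𝓡 1) 𝓘(ℝ, ℂ) 1 (fun w : Circle => (w : ℂ)) :=
    haveI := Complex.finrank_real_complex_fact
    contMDiff_coe_sphere (n := 1) (E := ℂ)
  obtain ⟨t, rfl⟩ := Circle.exp_surjective z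
  have h1 := ((hc.mdifferentiable one_ne_zero) (Circle.exp t)).hasMFDerivAt.comp t
    ((contMDiff_circleExp (m := 1)).mdifferentiable one_ne_zero t).hasMFDerivAt
  have h2 : HasMFDerivAt 𝓘(ℝ, ℝ) 𝓘(ℝ, ℂ) (fun s : ℝ => (Circle.exp s : ℂ)) t
      (ContinuousLinearMap.toSpanSingleton ℝ ((Circle.exp t : ℂ) * Complex.I)) := by
    have h := ((Complex.ofRealCLM.hasDerivAt (x := t)).mul_const Complex.I).cexp
    have h' : HasDerivAt (fun s : ℝ => (Circle.exp s : ℂ)) ((Circle.exp t : ℂ) * Complex.I) t := by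
      simpa using h
    exact h'.hasFDerivAt.hasMFDerivAt
  have h3 := hasMFDerivAt_unique h1 h2
  symm
  -- The velocity of `Circle.exp` puts `i z` in the range, and the range is at most a line because
  -- the circle has dimension 1.
  refine Submodule.eq_of_le_of_finrank_le ?_ ?_
  · rw [Submodule.span_singleton_le_iff_mem]
    refine ⟨mfderiv 𝓘(ℝ, ℝ) (𝓡 1) Circle.exp t (1 : ℝ), ?_⟩
    refine (congrArg (fun L : ℝ →L[ℝ] ℂ => L 1) h3).trans ?_
    exact one_smul ℝ _
  · rw [finrank_span_singleton (mul_ne_zero (Circle.coe_ne_zero _) Complex.I_ne_zero)]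
    refine (LinearMap.finrank_range_le _).trans ?_
    exact (finrank_euclideanSpace_fin (𝕜 := ℝ) (n := 1)).le

/-- Scalar multiplication by `z` on `ℂ^m`, as a real linear automorphism. -/
def circleSMul (m : ℕ) (z : Circle) : CSpace m ≃ₗ[ℝ] CSpace m :=
  (LinearEquiv.smulOfNeZero ℂ (CSpace m) (z : ℂ) (Circle.coe_ne_zero z)).restrictScalars ℝ

lemma circleSMul_apply (m : ℕ) (z : Circle) (v : CSpace m) : circleSMul m z v = (z : ℂ) • v := rfl

lemma mfderiv_circleAction_apply
    (hρ : ContMDiff ((𝓡 d).prod 𝓘(ℝ, CSpace (n + 1))) 𝓘(ℝ, CSpace (n + 1)) ∞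
      (fun q : K × CSpace (n + 1) => ρ q.1 q.2)) (p : CSpace (n + 1)) (z : Circle) (g : K)
    (s : EuclideanSpace ℝ (Fin 1)) (X : EuclideanSpace ℝ (Fin d)) :
    (mfderiv ((𝓡 1).prod (𝓡 d)) 𝓘(ℝ, CSpace (n + 1))
        (fun q : Circle × K => circleAction ρ q p) (z, g) (s, X) : CSpace (n + 1)) =
      circleCoeDeriv z s • ρ g p +
      (z : ℂ) • orbitMapDeriv d ρ p g X := by
  have hc : ContMDiff (𝓡 1) 𝓘(ℝ, ℂ) 1 (fun w : Circle => (w : ℂ)) :=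
    haveI := Complex.finrank_real_complex_fact
    contMDiff_coe_sphere (n := 1) (E := ℂ)
  have hΦ := (contMDiff_orbitMap hρ p).of_le (m := 1) (by norm_num)
  have hs : ContDiff ℝ 1 (fun q : ℂ × CSpace (n + 1) => q.1 • q.2) := contDiff_smul
  have hf : ContMDiff ((𝓡 1).prod (𝓡 d)) 𝓘(ℝ, CSpace (n + 1)) 1
      (fun q : Circle × K => circleAction ρ q p) :=
    hs.contMDiff.comp ((hc.comp contMDiff_fst).prodMk_space (hΦ.comp contMDiff_snd))
  have h1 : HasMFDerivAt (𝓡 1) 𝓘(ℝ, CSpace (n + 1)) (fun w : Circle => (w : ℂ) • ρ g p) z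
      (((ContinuousLinearMap.id ℝ ℂ).smulRight (ρ g p)).comp
        (circleCoeDeriv z)) :=
    ((ContinuousLinearMap.id ℝ ℂ).smulRight (ρ g p)).hasMFDerivAt.comp z
      (hc.mdifferentiable one_ne_zero z).hasMFDerivAt
  have h2 : HasMFDerivAt (𝓡 d) 𝓘(ℝ, CSpace (n + 1)) (fun h : K => (z : ℂ) • ρ h p) g
      (((z : ℂ) • ContinuousLinearMap.id ℝ (CSpace (n + 1))).comp
        (orbitMapDeriv d ρ p g)) :=
    ((z : ℂ) • ContinuousLinearMap.id ℝ (CSpace (n + 1))).hasMFDerivAt.comp g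
      (hΦ.mdifferentiable one_ne_zero g).hasMFDerivAt
  refine (mfderiv_prod_eq_add_apply (hf.mdifferentiable one_ne_zero (z, g))).trans ?_
  exact congrArg₂ (fun (L : EuclideanSpace ℝ (Fin 1) →L[ℝ] CSpace (n + 1))
    (L' : EuclideanSpace ℝ (Fin d) →L[ℝ] CSpace (n + 1)) => L s + L' X) h1.mfderiv h2.mfderiv

/-- By the product rule a tangent vector is `(a z i) • ρ g p + z • w` with `a` real and `w` tangent
to the `K`-orbit; the factor `z` comes out. -/
lemma orbitTangent_circleAction
    (hρ : ContMDiff ((𝓡 d).prod 𝓘(ℝ, CSpace (n + 1))) 𝓘(ℝ, CSpace (n + 1)) ∞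
      (fun q : K × CSpace (n + 1) => ρ q.1 q.2)) (p : CSpace (n + 1)) (z : Circle) (g : K) :
    orbitTangent ((𝓡 1).prod (𝓡 d)) 𝓘(ℝ, CSpace (n + 1)) (circleAction ρ) p (z, g) =
      (coneOrbitTangent d ρ p g).map (circleSMul (n + 1) z).toLinearMap := by
  have h3 := mfderiv_circleAction_apply hρ p z g
  have hz := range_circleCoeDeriv z
  apply le_antisymm
  · rintro _ ⟨⟨s, X⟩, rfl⟩
    obtain ⟨a, ha⟩ := Submodule.mem_span_singleton.1 (hz.le ⟨s, rfl⟩)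
    refine ⟨a • Complex.I • ρ g p +
      orbitMapDeriv d ρ p g X, ?_, ?_⟩
    · exact Submodule.add_mem_sup (Submodule.smul_mem _ _ (Submodule.mem_span_singleton_self _))
        ⟨X, rfl⟩
    · refine Eq.trans ?_ (h3 s X).symm
      refine Eq.trans ?_ (congrArg (fun c : ℂ => c • ρ g p + (z : ℂ) •
        orbitMapDeriv d ρ p g X) ha)
      change (z : ℂ) • (a • Complex.I • ρ g p + _) = _
      rw [smul_add, smul_comm (z : ℂ) a, smul_smul, smul_assoc]
  · rintro _ ⟨u, hu, rfl⟩
    obtain ⟨v, hv, w, ⟨X, rfl⟩, rfl⟩ := Submodule.mem_sup.1 hu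
    obtain ⟨a, rfl⟩ := Submodule.mem_span_singleton.1 hv
    obtain ⟨s, hs⟩ := hz.ge (Submodule.smul_mem _ a (Submodule.mem_span_singleton_self _))
    refine ⟨(s, X), (h3 s X).trans ?_⟩
    refine (congrArg (fun c : ℂ => c • ρ g p + (z : ℂ) •
        orbitMapDeriv d ρ p g X) hs).trans ?_
    change _ = (z : ℂ) • (a • Complex.I • ρ g p + _)
    rw [smul_add, smul_comm (z : ℂ) a, smul_smul, smul_assoc]
    rfl

/-! ## Lagrangian orbits -/

lemma stdForm_circleSMul (m : ℕ) (z : Circle) (u v : CSpace m) :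
    stdForm m (circleSMul m z u) (circleSMul m z v) = stdForm m u v := by
  rw [stdForm_apply, stdForm_apply, circleSMul_apply, circleSMul_apply, inner_smul_left,
    inner_smul_right, ← mul_assoc, Complex.conj_mul', Circle.norm_coe]
  simp

/-- The linear criterion `lagrangian_iff_map_lineDeriv` is applied at each `ρ g p`. The right-hand
side is shared with `isLagrangianOrbit_circleAction_iff`, so the two orbits are compared through it.
-/
lemma isLagrangianOrbit_projAction_iff
    (hρ : ContMDiff ((𝓡 d).prod 𝓘(ℝ, CSpace (n + 1))) 𝓘(ℝ, CSpace (n + 1)) ∞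
      (fun q : K × CSpace (n + 1) => ρ q.1 q.2))
    (hu : ∀ (k : K) v, ‖ρ k v‖ = ‖v‖) {p : CSpace (n + 1)} (hp : p ≠ 0) :
    IsLagrangianOrbit (𝓡 d) 𝓘(ℝ, CSpace n) (fubiniStudy n) (projAction ρ) (lineOf p) ↔
      ∀ g : K, 2 * Module.finrank ℝ (coneOrbitTangent d ρ p g) =
          Module.finrank ℝ (CSpace (n + 1)) ∧
        ∀ u ∈ coneOrbitTangent d ρ p g, ∀ v ∈ coneOrbitTangent d ρ p g,
          stdForm (n + 1) u v = 0 := by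
  refine forall_congr' fun g => ?_
  have hΦ := (contMDiff_orbitMap hρ p).mdifferentiable (by simp) g
  rw [lagrangian_iff_map_lineDeriv ((LinearEquiv.map_ne_zero_iff (ρ g)).2 hp) _
    (fun u h => re_inner_eq_zero_of_mem_coneOrbitTangent hΦ (fun k => hu k p) h)
    (Submodule.mem_sup_left (Submodule.mem_span_singleton_self _)),
    map_lineDeriv_coneOrbitTangent hp, orbitTangent_projAction hp hΦ]
  refine and_congr Iff.rfl (forall₂_congr fun u _ => forall₂_congr fun v _ => ?_)
  exact Eq.congr_left (fubiniStudy_congr (projAction_lineOf g hp) u v)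

/-- Multiplication by `z` is a real linear automorphism preserving `stdForm`, so the condition at
`(z, g)` depends on `g` alone. -/
lemma isLagrangianOrbit_circleAction_iff
    (hρ : ContMDiff ((𝓡 d).prod 𝓘(ℝ, CSpace (n + 1))) 𝓘(ℝ, CSpace (n + 1)) ∞
      (fun q : K × CSpace (n + 1) => ρ q.1 q.2)) (p : CSpace (n + 1)) :
    IsLagrangianOrbit ((𝓡 1).prod (𝓡 d)) 𝓘(ℝ, CSpace (n + 1)) (stdFormField (n + 1))
        (circleAction ρ) p ↔
      ∀ g : K, 2 * Module.finrank ℝ (coneOrbitTangent d ρ p g) =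
          Module.finrank ℝ (CSpace (n + 1)) ∧
        ∀ u ∈ coneOrbitTangent d ρ p g, ∀ v ∈ coneOrbitTangent d ρ p g,
          stdForm (n + 1) u v = 0 := by
  have key : ∀ (z : Circle) (g : K) (T : Submodule ℝ (CSpace (n + 1))),
      (2 * Module.finrank ℝ (T.map (circleSMul (n + 1) z).toLinearMap) =
          Module.finrank ℝ (CSpace (n + 1)) ∧
        ∀ u ∈ T.map (circleSMul (n + 1) z).toLinearMap,
          ∀ v ∈ T.map (circleSMul (n + 1) z).toLinearMap, stdForm (n + 1) u v = 0) ↔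
      (2 * Module.finrank ℝ T = Module.finrank ℝ (CSpace (n + 1)) ∧
        ∀ u ∈ T, ∀ v ∈ T, stdForm (n + 1) u v = 0) := by
    intro z g T
    refine and_congr (by rw [← LinearEquiv.finrank_eq ((circleSMul (n + 1) z).submoduleMap T)]) ?_
    constructor
    · intro h u hu v hv
      rw [← stdForm_circleSMul (n + 1) z]
      exact h _ ⟨u, hu, rfl⟩ _ ⟨v, hv, rfl⟩
    · rintro h _ ⟨u, hu, rfl⟩ _ ⟨v, hv, rfl⟩
      exact (stdForm_circleSMul (n + 1) z u v).trans (h u hu v hv)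
  constructor
  · intro h g
    have := h (1, g)
    rw [orbitTangent_circleAction hρ] at this
    exact (key 1 g _).1 this
  · rintro h ⟨z, g⟩
    rw [orbitTangent_circleAction hρ]
    exact (key z g _).2 (h g)

/-- The orbit of the origin is a point, of dimension 0, whereas a Lagrangian orbit has dimension `n
+ 1 > 0`. -/
lemma ne_zero_of_isLagrangianOrbit_circleAction {p : CSpace (n + 1)}
    (h : IsLagrangianOrbit ((𝓡 1).prod (𝓡 d)) 𝓘(ℝ, CSpace (n + 1)) (stdFormField (n + 1))
      (circleAction ρ) p) : p ≠ 0 := by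
  rintro rfl
  have h1 := (h (1, 1)).1
  have h2 : (fun q : Circle × K => circleAction ρ q 0) = fun _ => 0 := by
    funext q
    simp [circleAction]
  have h3 : orbitTangent ((𝓡 1).prod (𝓡 d)) 𝓘(ℝ, CSpace (n + 1)) (circleAction ρ) 0 (1, 1) =
      ⊥ := by
    rw [orbitTangent, h2, mfderiv_const]
    exact LinearMap.range_zero
  rw [h3, finrank_bot] at h1
  change 2 * 0 = Module.finrank ℝ (CSpace (n + 1)) at h1
  rw [finrank_real_of_complex, finrank_euclideanSpace_fin] at h1
  omega

end Representation

end

theorem mainTheorem9 (n d : ℕ) (K : Type*) [TopologicalSpace K]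
    [ChartedSpace (EuclideanSpace ℝ (Fin d)) K] [Group K] [LieGroup (𝓡 d) ∞ K] [CompactSpace K]
    [LieAlgebra.IsSemisimple ℝ (GroupLieAlgebra (𝓡 d) K)]
    (ρ : K →* (CSpace (n + 1) ≃ₗ[ℂ] CSpace (n + 1)))
    (hρ : ContMDiff ((𝓡 d).prod 𝓘(ℝ, CSpace (n + 1))) 𝓘(ℝ, CSpace (n + 1)) ∞
      (fun q : K × CSpace (n + 1) => ρ q.1 q.2))
    (hK : IsHamiltonianAction (𝓡 d) 𝓘(ℝ, CSpace n) (CProj.fubiniStudy n) (projAction ρ)) :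
    HasLagrangianOrbit (𝓡 d) 𝓘(ℝ, CSpace n) (CProj.fubiniStudy n) (projAction ρ) ↔
      HasLagrangianOrbit ((𝓡 1).prod (𝓡 d)) 𝓘(ℝ, CSpace (n + 1)) (stdFormField (n + 1))
        (circleAction ρ) := by
  have hu := norm_map_eq_of_isHamiltonianAction hρ hK
  constructor
  · rintro ⟨ℓ, h⟩
    rw [← ℓ.mk_rep, ← CProj.lineOf_of_ne_zero ℓ.rep_nonzero,
      isLagrangianOrbit_projAction_iff hρ hu ℓ.rep_nonzero] at h
    exact ⟨ℓ.rep, (isLagrangianOrbit_circleAction_iff hρ _).2 h⟩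
  · rintro ⟨p, h⟩
    have hp := ne_zero_of_isLagrangianOrbit_circleAction h
    exact ⟨CProj.lineOf p, (isLagrangianOrbit_projAction_iff hρ hu hp).2
      ((isLagrangianOrbit_circleAction_iff hρ p).1 h)⟩
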